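/- Let $M^3$ be a connected smooth 3-dimensional manifold with a para-cosymplectic structure $(\phi,\zeta,\eta,g)$. This means: $\phi$ is a smooth $(1,1)$-tensor field, $\zeta$ a smooth vector field, $\eta$ a smooth one-form and $g$ a smooth semi-Riemannian metric on $M^3$ with $$\phi^2=I-\eta\otimes\zeta,\qquad \eta(\zeta)=1,\qquad g(\phi X,\phi Y)=-g(X,Y)+\eta(X)\eta(Y);$$ the $(+1)$- and $(-1)$-eigendistributions of $\phi$ have equal dimension; $d\eta=0$ and $d\Phi=0$, where $\Phi(X,Y)=g(X,\phi Y)$; and the Nijenhuis tensor of $\phi$ vanishes. Let $S$ be the Ricci tensor of $g$. Let $h$ be a constant function and let $f,\lambda$ be smooth functions on $M^3$ such that $(g,f,h,\lambda)$ is an $h$-almost gradient Ricci soliton, i.e. $$h\,\nabla^2 f+\lambda g+S=0 .$$ Then $\lambda$ is constant; that is, the $h$-almost gradient Ricci soliton is an $h$-gradient Ricci soliton. No assumption is made on the scalar curvature. -/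

import Mathlib

open scoped Manifold ContDiff

noncomputable section

namespace ParaGeom

/-- The model space `ℝᵈ`. -/
abbrev Model (d : ℕ) : Type := EuclideanSpace ℝ (Fin d)

/-! ## Coordinate calculus on open subsets of `ℝᵈ`

A metric on (an open subset of) `ℝᵈ` is given by its field of bilinear forms `G`. -/

section Coordinates

variable {d : ℕ}

/-- The Christoffel symbols of the Levi-Civita connection of `G`: `christoffel G y u v` is the
vector `Γ(u, v)` at `y` determined by
`2 G(Γ(u, v), w) = ∂_u G(v, w) + ∂_v G(u, w) - ∂_w G(u, v)` for all `w`,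
so that `∇_U V = ∂_U V + Γ(U, V)`. -/
def christoffel (G : Model d → Model d →L[ℝ] Model d →L[ℝ] ℝ) (y u v : Model d) : Model d :=
  (G y).inverse ((1 / 2 : ℝ) •
    (fderiv ℝ G y u v + fderiv ℝ G y v u - ((fderiv ℝ G y).flip u).flip v))

/-- The curvature `R(u, v) w = ∇_u ∇_v w - ∇_v ∇_u w` for constant coordinate fields `u, v, w`
(whose brackets vanish). -/
def curvature (G : Model d → Model d →L[ℝ] Model d →L[ℝ] ℝ) (y u v w : Model d) : Model d :=
  fderiv ℝ (fun z => christoffel G z v w) y u - fderiv ℝ (fun z => christoffel G z u w) y v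
    + christoffel G y u (christoffel G y v w) - christoffel G y v (christoffel G y u w)

/-- The Ricci tensor `S(v, w) = trace (u ↦ R(u, v) w)`. -/
def ricci (G : Model d → Model d →L[ℝ] Model d →L[ℝ] ℝ) (y v w : Model d) : ℝ :=
  ∑ i : Fin d, curvature G y (EuclideanSpace.single i 1) v w i

/-- The scalar curvature `r = ∑ gⁱʲ S(e_i, e_j)`; here `gⁱʲ` is the `j`-th coordinate of the vector
which is `G`-dual to the `i`-th coordinate covector. -/
def scalarCurvature (G : Model d → Model d →L[ℝ] Model d →L[ℝ] ℝ) (y : Model d) : ℝ :=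
  ∑ i : Fin d, ∑ j : Fin d,
    (G y).inverse (EuclideanSpace.proj i) j *
      ricci G y (EuclideanSpace.single i 1) (EuclideanSpace.single j 1)

/-- The Hessian `∇²F(u, v) = ∂_u ∂_v F - dF(Γ(u, v))`. -/
def hessian (G : Model d → Model d →L[ℝ] Model d →L[ℝ] ℝ) (F : Model d → ℝ) (y u v : Model d) :
    ℝ :=
  fderiv ℝ (fderiv ℝ F) y u v - fderiv ℝ F y (christoffel G y u v)

/-- The exterior derivative of a one-form, on constant coordinate fields. -/
def extDerivOne (η : Model d → Model d →L[ℝ] ℝ) (y u v : Model d) : ℝ :=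
  fderiv ℝ η y u v - fderiv ℝ η y v u

/-- The exterior derivative of a two-form, on constant coordinate fields. -/
def extDerivTwo (Φ : Model d → Model d →L[ℝ] Model d →L[ℝ] ℝ) (y u v w : Model d) : ℝ :=
  fderiv ℝ Φ y u v w + fderiv ℝ Φ y v w u + fderiv ℝ Φ y w u v

/-- The Nijenhuis tensor
`N(U, V) = φ²[U, V] + [φU, φV] - φ[φU, V] - φ[U, φV]` of a `(1,1)`-tensor field, on constant
coordinate fields `u, v`. -/
def nijenhuis (φ : Model d → Model d →L[ℝ] Model d) (y u v : Model d) : Model d :=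
  φ y (φ y (VectorField.lieBracket ℝ (fun _ => u) (fun _ => v) y))
    + VectorField.lieBracket ℝ (fun z => φ z u) (fun z => φ z v) y
    - φ y (VectorField.lieBracket ℝ (fun z => φ z u) (fun _ => v) y)
    - φ y (VectorField.lieBracket ℝ (fun _ => u) (fun z => φ z v) y)

end Coordinates

/-! ## Tensor fields on manifolds and their coordinate expressions -/

section Manifold

variable {d : ℕ} {M : Type*} [TopologicalSpace M] [ChartedSpace (Model d) M]

variable [IsManifold (𝓡 d) ∞ M]

/-- The coordinate frame of the chart at `x₀`, at the point with coordinates `y`: the inverse of the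
trivialization of the tangent bundle given by this chart. For `y` in the target of the chart this
is the differential at `y` of the inverse chart. -/
def frame (x₀ : M) (y : Model d) :
    Model d →L[ℝ] TangentSpace (𝓡 d) ((extChartAt (𝓡 d) x₀).symm y) :=
  (trivializationAt (Model d) (TangentSpace (𝓡 d)) x₀).symmL ℝ ((extChartAt (𝓡 d) x₀).symm y)

/-- The coordinate coframe of the chart at `x₀`, at the point with coordinates `y`. For `y` in the
target of the chart this is the differential of the chart at this point, the inverse of `frame`. -/
def coframe (x₀ : M) (y : Model d) :
    TangentSpace (𝓡 d) ((extChartAt (𝓡 d) x₀).symm y) →L[ℝ] Model d :=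
  (trivializationAt (Model d) (TangentSpace (𝓡 d)) x₀).continuousLinearMapAt ℝ
    ((extChartAt (𝓡 d) x₀).symm y)

/-- Coordinate expression of a function in the chart at `x₀`. -/
def coordFun (f : M → ℝ) (x₀ : M) (y : Model d) : ℝ :=
  f ((extChartAt (𝓡 d) x₀).symm y)

/-- Coordinate expression of a one-form in the chart at `x₀`. -/
def coordOneForm (η : ∀ x : M, TangentSpace (𝓡 d) x →L[ℝ] ℝ) (x₀ : M) (y : Model d) :
    Model d →L[ℝ] ℝ :=
  (η ((extChartAt (𝓡 d) x₀).symm y)).comp (frame x₀ y)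

/-- Coordinate expression of a field of bilinear forms in the chart at `x₀`. -/
def coordBilin (B : ∀ x : M, TangentSpace (𝓡 d) x →L[ℝ] TangentSpace (𝓡 d) x →L[ℝ] ℝ)
    (x₀ : M) (y : Model d) : Model d →L[ℝ] Model d →L[ℝ] ℝ :=
  ((frame x₀ y).precomp ℝ).comp ((B ((extChartAt (𝓡 d) x₀).symm y)).comp (frame x₀ y))

/-- Coordinate expression of a field of endomorphisms in the chart at `x₀`. -/
def coordEnd (φ : ∀ x : M, TangentSpace (𝓡 d) x →L[ℝ] TangentSpace (𝓡 d) x)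
    (x₀ : M) (y : Model d) : Model d →L[ℝ] Model d :=
  (coframe x₀ y).comp ((φ ((extChartAt (𝓡 d) x₀).symm y)).comp (frame x₀ y))

variable (d M) in
/-- A smooth semi-Riemannian metric: a smooth field of nondegenerate symmetric bilinear forms
(of arbitrary signature). -/
structure SemiRiemannianMetric where
  inner (x : M) : TangentSpace (𝓡 d) x →L[ℝ] TangentSpace (𝓡 d) x →L[ℝ] ℝ
  symm (x : M) (u v : TangentSpace (𝓡 d) x) : inner x u v = inner x v u
  nondegenerate (x : M) (u : TangentSpace (𝓡 d) x) (hu : ∀ v, inner x u v = 0) : u = 0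
  contMDiff : ContMDiff (𝓡 d) ((𝓡 d).prod 𝓘(ℝ, Model d →L[ℝ] Model d →L[ℝ] ℝ)) ∞
    (fun x => Bundle.TotalSpace.mk' (Model d →L[ℝ] Model d →L[ℝ] ℝ)
      (E := fun x : M => TangentSpace (𝓡 d) x →L[ℝ] TangentSpace (𝓡 d) x →L[ℝ] ℝ) x (inner x))

variable (d M) in
/-- A (smooth) almost paracontact metric structure `(φ, ζ, η, g)`. -/
structure AlmostParacontactMetricStructure where
  /-- the `(1,1)`-tensor field -/
  φ (x : M) : TangentSpace (𝓡 d) x →L[ℝ] TangentSpace (𝓡 d) x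
  /-- the characteristic vector field -/
  ζ (x : M) : TangentSpace (𝓡 d) x
  /-- the one-form -/
  η (x : M) : TangentSpace (𝓡 d) x →L[ℝ] ℝ
  /-- the compatible metric -/
  g : SemiRiemannianMetric d M
  contMDiff_φ : ContMDiff (𝓡 d) ((𝓡 d).prod 𝓘(ℝ, Model d →L[ℝ] Model d)) ∞
    (fun x => Bundle.TotalSpace.mk' (Model d →L[ℝ] Model d)
      (E := fun x : M => TangentSpace (𝓡 d) x →L[ℝ] TangentSpace (𝓡 d) x) x (φ x))
  contMDiff_ζ : ContMDiff (𝓡 d) (𝓡 d).tangent ∞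
    (fun x => (⟨x, ζ x⟩ : TangentBundle (𝓡 d) M))
  contMDiff_η : ContMDiff (𝓡 d) ((𝓡 d).prod 𝓘(ℝ, Model d →L[ℝ] ℝ)) ∞
    (fun x => Bundle.TotalSpace.mk' (Model d →L[ℝ] ℝ)
      (E := fun x : M => TangentSpace (𝓡 d) x →L[ℝ] ℝ) x (η x))
  φ_sq (x : M) (u : TangentSpace (𝓡 d) x) : φ x (φ x u) = u - η x u • ζ x
  η_ζ (x : M) : η x (ζ x) = 1
  /-- the eigendistributions of `φ` for the eigenvalues `1` and `-1` have equal dimension -/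
  finrank_eigenspace (x : M) :
    Module.finrank ℝ (Module.End.eigenspace (φ x : Module.End ℝ (TangentSpace (𝓡 d) x)) 1) =
      Module.finrank ℝ (Module.End.eigenspace (φ x : Module.End ℝ (TangentSpace (𝓡 d) x)) (-1))
  compatible (x : M) (u v : TangentSpace (𝓡 d) x) :
    g.inner x (φ x u) (φ x v) = -g.inner x u v + η x u * η x v

namespace AlmostParacontactMetricStructure

/-- The fundamental two-form `Φ(X, Y) = g(X, φ Y)`. -/
def fundamentalForm (A : AlmostParacontactMetricStructure d M) (x : M) :
    TangentSpace (𝓡 d) x →L[ℝ] TangentSpace (𝓡 d) x →L[ℝ] ℝ :=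
  ((A.φ x).precomp ℝ).comp (A.g.inner x)

/-- Para-cosymplectic: `dη = 0`, `dΦ = 0`, and normal (the Nijenhuis tensor of `φ` vanishes).
The three tensor identities are required in every chart. -/
structure IsParaCosymplectic (A : AlmostParacontactMetricStructure d M) : Prop where
  d_eta : ∀ x₀ : M, ∀ y ∈ (extChartAt (𝓡 d) x₀).target, ∀ u v : Model d,
    extDerivOne (coordOneForm A.η x₀) y u v = 0
  d_fundamentalForm : ∀ x₀ : M, ∀ y ∈ (extChartAt (𝓡 d) x₀).target, ∀ u v w : Model d,
    extDerivTwo (coordBilin A.fundamentalForm x₀) y u v w = 0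
  normal : ∀ x₀ : M, ∀ y ∈ (extChartAt (𝓡 d) x₀).target, ∀ u v : Model d,
    nijenhuis (coordEnd A.φ x₀) y u v = 0

end AlmostParacontactMetricStructure

/-- `h`-almost gradient Ricci-Yamabe soliton with potential `f` and soliton function `lam`: the
functions are smooth and `h ∇²f + (lam - (β/2) r) g + α S = 0`, as an identity of tensors in every
chart. -/
structure IsHAlmostGradientRicciYamabeSoliton (g : SemiRiemannianMetric d M)
    (h f lam : M → ℝ) (α β : ℝ) : Prop where
  contMDiff_h : ContMDiff (𝓡 d) 𝓘(ℝ, ℝ) ∞ h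
  contMDiff_f : ContMDiff (𝓡 d) 𝓘(ℝ, ℝ) ∞ f
  contMDiff_lam : ContMDiff (𝓡 d) 𝓘(ℝ, ℝ) ∞ lam
  soliton_eq : ∀ x₀ : M, ∀ y ∈ (extChartAt (𝓡 d) x₀).target, ∀ u v : Model d,
    coordFun h x₀ y * hessian (coordBilin g.inner x₀) (coordFun f x₀) y u v
      + (coordFun lam x₀ y - β / 2 * scalarCurvature (coordBilin g.inner x₀) y)
          * coordBilin g.inner x₀ y u v
      + α * ricci (coordBilin g.inner x₀) y u v = 0

/-- `h`-gradient Ricci-Yamabe soliton: the soliton function is constant. -/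
def IsHGradientRicciYamabeSoliton (g : SemiRiemannianMetric d M)
    (h f lam : M → ℝ) (α β : ℝ) : Prop :=
  IsHAlmostGradientRicciYamabeSoliton g h f lam α β ∧ ∃ c : ℝ, ∀ x, lam x = c

/-- `h`-almost gradient Ricci soliton: the case `α = 1`, `β = 0`. -/
def IsHAlmostGradientRicciSoliton (g : SemiRiemannianMetric d M) (h f lam : M → ℝ) : Prop :=
  IsHAlmostGradientRicciYamabeSoliton g h f lam 1 0

/-- `h`-gradient Ricci soliton: the case `α = 1`, `β = 0`. -/
def IsHGradientRicciSoliton (g : SemiRiemannianMetric d M) (h f lam : M → ℝ) : Prop :=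
  IsHGradientRicciYamabeSoliton g h f lam 1 0

end Manifold

end ParaGeom

end

/-! The characteristic field ζ is parallel, and this forces the derivative of λ to vanish. Normality
together with dη = 0 gives L_ζφ = 0 (`lieDerivative_φ`). Then dΦ = 0 makes ζ a Killing field
(`lieDerivative_metric`), and a Killing field whose dual form η is closed is parallel (`fderiv_ζ`).
Consequently R(·,·)ζ = 0 and R(ζ,·) = 0, so S(·,ζ) = 0, and the second Bianchi identity yields ∇_ζR
= 0 and ∇_ζS = 0 (`fderiv_ricci_ζ`).

With h = c, differentiating the soliton equation along ζ on (u, v), and along u on (v, ζ), gives c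
(∇_ζ∇²f)(u, v) + ζ(λ) g(u, v) = 0 and c (∇_u∇²f)(v, ζ) + u(λ) η(v) = 0. By the Ricci identity the
two third-order terms differ by df(R(ζ, u)v) up to sign, which is zero; hence ζ(λ) g(u, v) = u(λ)
η(v) (`fderiv_solitonFunction`). A nonzero v in ker η gives ζ(λ) = 0 by nondegeneracy, and then v =
ζ gives u(λ) = 0. There is no division by c, and dimension at least 2 suffices. Everything is
computed in charts, and connectedness makes λ globally constant. -/

noncomputable section

namespace ParaGeom

section Coordinates

set_option maxSynthPendingDepth 4

/-! ### Product rules and symmetry of second derivatives on open sets. -/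

section Calculus

variable {E F₁ F₂ F₃ : Type*} [NormedAddCommGroup E] [NormedSpace ℝ E]
  [NormedAddCommGroup F₁] [NormedSpace ℝ F₁] [NormedAddCommGroup F₂] [NormedSpace ℝ F₂]
  [NormedAddCommGroup F₃] [NormedSpace ℝ F₃] {U : Set E} {y : E}

theorem fderiv_eq_of_eqOn {f g : E → F₁} (hU : IsOpen U) (h : ∀ z ∈ U, f z = g z) (hy : y ∈ U) :
    fderiv ℝ f y = fderiv ℝ g y :=
  Filter.EventuallyEq.fderiv_eq (Filter.eventually_of_mem (hU.mem_nhds hy) h)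

theorem fderiv_apply_field {c : E → F₁ →L[ℝ] F₂} {u : E → F₁} (hc : DifferentiableAt ℝ c y)
    (hu : DifferentiableAt ℝ u y) (x : E) :
    fderiv ℝ (fun z => c z (u z)) y x = fderiv ℝ c y x (u y) + c y (fderiv ℝ u y x) := by
  rw [fderiv_clm_apply hc hu]
  simp [add_comm]

theorem fderiv_apply_const {c : E → F₁ →L[ℝ] F₂} (hc : DifferentiableAt ℝ c y) (u : F₁) (x : E) :
    fderiv ℝ (fun z => c z u) y x = fderiv ℝ c y x u := by
  rw [fderiv_apply_field hc (differentiableAt_const u)]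
  simp

theorem fderiv_apply_field₂ {c : E → F₁ →L[ℝ] F₂ →L[ℝ] F₃} {u : E → F₁} {v : E → F₂}
    (hc : DifferentiableAt ℝ c y) (hu : DifferentiableAt ℝ u y) (hv : DifferentiableAt ℝ v y)
    (x : E) :
    fderiv ℝ (fun z => c z (u z) (v z)) y x =
      fderiv ℝ c y x (u y) (v y) + c y (fderiv ℝ u y x) (v y) + c y (u y) (fderiv ℝ v y x) := by
  rw [fderiv_apply_field (hc.clm_apply hu) hv, fderiv_apply_field hc hu]
  simp

theorem fderiv_apply_const₂ {c : E → F₁ →L[ℝ] F₂ →L[ℝ] F₃} (hc : DifferentiableAt ℝ c y)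
    (u : F₁) (v : F₂) (x : E) :
    fderiv ℝ (fun z => c z u v) y x = fderiv ℝ c y x u v := by
  rw [fderiv_apply_field₂ hc (differentiableAt_const u) (differentiableAt_const v)]
  simp

theorem contDiffOn_fderiv {f : E → F₁} (hU : IsOpen U) (hf : ContDiffOn ℝ ∞ f U) :
    ContDiffOn ℝ ∞ (fderiv ℝ f) U :=
  hf.fderiv_of_isOpen hU (by simp)

theorem differentiableAt_of_contDiffOn {f : E → F₁} (hU : IsOpen U) (hf : ContDiffOn ℝ ∞ f U)
    (hy : y ∈ U) : DifferentiableAt ℝ f y :=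
  (hf.contDiffAt (hU.mem_nhds hy)).differentiableAt (by simp)

theorem fderiv_fderiv_symm {f : E → F₁} (hU : IsOpen U) (hf : ContDiffOn ℝ ∞ f U)
    (hy : y ∈ U) (u v : E) : fderiv ℝ (fderiv ℝ f) y u v = fderiv ℝ (fderiv ℝ f) y v u :=
  ((hf.contDiffAt (hU.mem_nhds hy)).isSymmSndFDerivAt
    (by simpa using WithTop.coe_le_coe.2 (le_top : (2 : ℕ∞) ≤ ⊤))).eq u v

end Calculus

variable {d : ℕ}

theorem sum_apply_single_eq_trace (L : Model d →L[ℝ] Model d) :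
    ∑ i : Fin d, L (EuclideanSpace.single i 1) i =
      LinearMap.trace ℝ (Model d) (L : Model d →ₗ[ℝ] Model d) := by
  rw [LinearMap.trace_eq_sum_inner _ (EuclideanSpace.basisFun (Fin d) ℝ)]
  simp [EuclideanSpace.inner_single_left]

/-- The Ricci tensor is a coordinate sum; reading such sums as traces shows that commutators
contribute nothing to it. -/
theorem sum_comp_apply_single_comm (L T : Model d →L[ℝ] Model d) :
    ∑ i : Fin d, L (T (EuclideanSpace.single i 1)) i =
      ∑ i : Fin d, T (L (EuclideanSpace.single i 1)) i := by
  have h₁ := sum_apply_single_eq_trace (L.comp T)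
  have h₂ := sum_apply_single_eq_trace (T.comp L)
  simp only [ContinuousLinearMap.comp_apply] at h₁ h₂
  rw [h₁, h₂]
  exact LinearMap.trace_mul_comm ℝ (L : Model d →ₗ[ℝ] Model d) (T : Model d →ₗ[ℝ] Model d)

/-! ### Levi-Civita connection and curvature of a metric in coordinates. -/

/-- A smooth semi-Riemannian metric on an open subset of `ℝᵈ`. -/
structure IsMetricOn (G : Model d → Model d →L[ℝ] Model d →L[ℝ] ℝ) (U : Set (Model d)) : Prop where
  isOpen : IsOpen U
  contDiffOn : ContDiffOn ℝ ∞ G U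
  symm : ∀ y ∈ U, ∀ u v, G y u v = G y v u
  nondegenerate : ∀ y ∈ U, ∀ u, (∀ v, G y u v = 0) → u = 0

/-- The Christoffel symbols as a field of bundled bilinear maps. -/
def christoffelCLM (G : Model d → Model d →L[ℝ] Model d →L[ℝ] ℝ) (y : Model d) :
    Model d →L[ℝ] Model d →L[ℝ] Model d :=
  (ContinuousLinearMap.compL ℝ (Model d) (Model d →L[ℝ] ℝ) (Model d) (G y).inverse).comp
    ((1 / 2 : ℝ) • (fderiv ℝ G y + (fderiv ℝ G y).flip -
      ((ContinuousLinearMap.flipₗᵢ ℝ (Model d) (Model d) ℝ :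
        (Model d →L[ℝ] Model d →L[ℝ] ℝ) →L[ℝ] Model d →L[ℝ] Model d →L[ℝ] ℝ).comp
          (fderiv ℝ G y).flip)))

/-- The curvature as a field of bundled trilinear maps. -/
def curvatureCLM (G : Model d → Model d →L[ℝ] Model d →L[ℝ] ℝ) (y : Model d) :
    Model d →L[ℝ] Model d →L[ℝ] Model d →L[ℝ] Model d :=
  fderiv ℝ (christoffelCLM G) y - (fderiv ℝ (christoffelCLM G) y).flip
    + (ContinuousLinearMap.compL ℝ (Model d) (Model d) (Model d)).bilinearComp
        (christoffelCLM G y) (christoffelCLM G y)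
    - ((ContinuousLinearMap.compL ℝ (Model d) (Model d) (Model d)).bilinearComp
        (christoffelCLM G y) (christoffelCLM G y)).flip

theorem christoffelCLM_apply (G : Model d → Model d →L[ℝ] Model d →L[ℝ] ℝ) (y u v : Model d) :
    christoffelCLM G y u v = christoffel G y u v := by
  simp [christoffelCLM, christoffel]

theorem curvatureCLM_apply (G : Model d → Model d →L[ℝ] Model d →L[ℝ] ℝ) (y u v : Model d) :
    curvatureCLM G y u v = fderiv ℝ (christoffelCLM G) y u v - fderiv ℝ (christoffelCLM G) y v u
      + (christoffelCLM G y u).comp (christoffelCLM G y v)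
      - (christoffelCLM G y v).comp (christoffelCLM G y u) := by
  simp [curvatureCLM]

theorem curvatureCLM_antisymm (G : Model d → Model d →L[ℝ] Model d →L[ℝ] ℝ) (y u v : Model d) :
    curvatureCLM G y u v = -curvatureCLM G y v u := by
  rw [curvatureCLM_apply, curvatureCLM_apply]
  abel

namespace IsMetricOn

variable {G : Model d → Model d →L[ℝ] Model d →L[ℝ] ℝ} {U : Set (Model d)}

/-- Nondegeneracy is injectivity, and the dimensions agree. Since `ContinuousLinearMap.inverse` is
zero on non-invertible maps, the formula for the Christoffel symbols has its meaning only through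
this. -/
theorem isInvertible (hG : IsMetricOn G U) {y : Model d} (hy : y ∈ U) : (G y).IsInvertible := by
  have hinj : Function.Injective (G y : Model d →ₗ[ℝ] (Model d →L[ℝ] ℝ)) := by
    rw [← LinearMap.ker_eq_bot, LinearMap.ker_eq_bot']
    intro u hu
    exact hG.nondegenerate y hy u fun v => by
      simpa using congrArg (fun l : Model d →L[ℝ] ℝ => l v) hu
  have hfr : Module.finrank ℝ (Model d) = Module.finrank ℝ (Model d →L[ℝ] ℝ) :=
    (InnerProductSpace.toDual ℝ (Model d)).toLinearEquiv.finrank_eq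
  refine ⟨(LinearEquiv.ofInjectiveOfFinrankEq _ hinj hfr).toContinuousLinearEquiv, ?_⟩
  ext u v
  rfl

theorem contDiffOn_christoffelCLM (hG : IsMetricOn G U) : ContDiffOn ℝ ∞ (christoffelCLM G) U := by
  have hD := contDiffOn_fderiv hG.isOpen hG.contDiffOn
  have hinv : ContDiffOn ℝ ∞ (fun y => (G y).inverse) U := fun y hy =>
    ((hG.isInvertible hy).contDiffAt_map_inverse.comp y
      (hG.contDiffOn.contDiffAt (hG.isOpen.mem_nhds hy))).contDiffWithinAt
  rw [contDiffOn_clm_apply]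
  intro u
  rw [contDiffOn_clm_apply]
  intro v
  simp only [christoffelCLM_apply, christoffel]
  refine hinv.clm_apply (ContDiffOn.const_smul _ (ContDiffOn.sub (ContDiffOn.add ?_ ?_) ?_))
  · exact (hD.clm_apply contDiffOn_const).clm_apply contDiffOn_const
  · exact (hD.clm_apply contDiffOn_const).clm_apply contDiffOn_const
  · rw [contDiffOn_clm_apply]
    intro w
    exact ((hD.clm_apply contDiffOn_const).clm_apply contDiffOn_const).clm_apply contDiffOn_const

theorem contDiffOn_curvatureCLM (hG : IsMetricOn G U) : ContDiffOn ℝ ∞ (curvatureCLM G) U := by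
  have hΓ := hG.contDiffOn_christoffelCLM
  have hD := contDiffOn_fderiv hG.isOpen hΓ
  rw [contDiffOn_clm_apply]
  intro u
  rw [contDiffOn_clm_apply]
  intro v
  simp only [curvatureCLM_apply]
  refine ContDiffOn.sub (ContDiffOn.add (ContDiffOn.sub ?_ ?_) ?_) ?_
  · exact (hD.clm_apply contDiffOn_const).clm_apply contDiffOn_const
  · exact (hD.clm_apply contDiffOn_const).clm_apply contDiffOn_const
  · exact (hΓ.clm_apply contDiffOn_const).clm_comp (hΓ.clm_apply contDiffOn_const)
  · exact (hΓ.clm_apply contDiffOn_const).clm_comp (hΓ.clm_apply contDiffOn_const)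

variable {y : Model d}

theorem differentiableAt (hG : IsMetricOn G U) (hy : y ∈ U) : DifferentiableAt ℝ G y :=
  differentiableAt_of_contDiffOn hG.isOpen hG.contDiffOn hy

theorem differentiableAt_christoffelCLM (hG : IsMetricOn G U) (hy : y ∈ U) :
    DifferentiableAt ℝ (christoffelCLM G) y :=
  differentiableAt_of_contDiffOn hG.isOpen hG.contDiffOn_christoffelCLM hy

theorem curvatureCLM_eq_curvature (hG : IsMetricOn G U) (hy : y ∈ U) (u v w : Model d) :
    curvatureCLM G y u v w = curvature G y u v w := by
  have hΓ := hG.differentiableAt_christoffelCLM hy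
  simp only [curvature, ← christoffelCLM_apply]
  rw [fderiv_apply_const₂ hΓ, fderiv_apply_const₂ hΓ, curvatureCLM_apply]
  simp

theorem fderiv_symm (hG : IsMetricOn G U) (hy : y ∈ U) (u v w : Model d) :
    fderiv ℝ G y u v w = fderiv ℝ G y u w v := by
  have hd := hG.differentiableAt hy
  rw [← fderiv_apply_const₂ hd, ← fderiv_apply_const₂ hd,
    fderiv_eq_of_eqOn hG.isOpen (fun z hz => hG.symm z hz v w) hy]

theorem inner_christoffelCLM (hG : IsMetricOn G U) (hy : y ∈ U) (u v w : Model d) :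
    2 * G y (christoffelCLM G y u v) w =
      fderiv ℝ G y u v w + fderiv ℝ G y v u w - fderiv ℝ G y w u v := by
  obtain ⟨e, he⟩ := hG.isInvertible hy
  rw [christoffelCLM_apply, christoffel, ← he, ContinuousLinearMap.inverse_equiv]
  simp

theorem eq_of_inner_eq (hG : IsMetricOn G U) (hy : y ∈ U) {u v : Model d}
    (h : ∀ w, G y u w = G y v w) : u = v :=
  sub_eq_zero.1 <| hG.nondegenerate y hy _ fun w => by simp [h w]

theorem christoffelCLM_symm (hG : IsMetricOn G U) (hy : y ∈ U) (u v : Model d) :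
    christoffelCLM G y u v = christoffelCLM G y v u := by
  refine hG.eq_of_inner_eq hy fun w => ?_
  have h₁ := hG.inner_christoffelCLM hy u v w
  have h₂ := hG.inner_christoffelCLM hy v u w
  have h₃ := hG.fderiv_symm hy w u v
  linarith

/-- The Levi-Civita connection is compatible with the metric. -/
theorem fderiv_eq (hG : IsMetricOn G U) (hy : y ∈ U) (u v w : Model d) :
    fderiv ℝ G y u v w =
      G y (christoffelCLM G y u v) w + G y v (christoffelCLM G y u w) := by
  have h₁ := hG.inner_christoffelCLM hy u v w
  have h₂ := hG.inner_christoffelCLM hy u w v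
  have h₃ := hG.fderiv_symm hy u v w
  have h₄ := hG.fderiv_symm hy v u w
  have h₅ := hG.fderiv_symm hy w u v
  rw [hG.symm y hy v]
  linarith

theorem fderiv_christoffelCLM_symm (hG : IsMetricOn G U) (hy : y ∈ U) (u v w : Model d) :
    fderiv ℝ (christoffelCLM G) y u v w = fderiv ℝ (christoffelCLM G) y u w v := by
  have hd := hG.differentiableAt_christoffelCLM hy
  rw [← fderiv_apply_const₂ hd, ← fderiv_apply_const₂ hd,
    fderiv_eq_of_eqOn hG.isOpen (fun z hz => hG.christoffelCLM_symm hz v w) hy]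

/-- The connection is torsion-free: by the symmetry of Γ and of its derivatives, the terms of the
cyclic sum cancel in pairs. -/
theorem first_bianchi (hG : IsMetricOn G U) (hy : y ∈ U) (u v w : Model d) :
    curvatureCLM G y u v w + curvatureCLM G y v w u + curvatureCLM G y w u v = 0 := by
  simp only [curvatureCLM_apply, add_apply, sub_apply,
    ContinuousLinearMap.comp_apply]
  rw [hG.fderiv_christoffelCLM_symm hy u w v, hG.fderiv_christoffelCLM_symm hy v u w,
    hG.fderiv_christoffelCLM_symm hy w v u, hG.christoffelCLM_symm hy w v,
    hG.christoffelCLM_symm hy u w, hG.christoffelCLM_symm hy v u]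
  abel

/-- Metric compatibility differentiated once more, with the first derivatives of the metric again
replaced by Christoffel terms. -/
theorem fderiv_fderiv_eq (hG : IsMetricOn G U) (hy : y ∈ U) (x u v w : Model d) :
    fderiv ℝ (fderiv ℝ G) y x u v w =
      G y (christoffelCLM G y x (christoffelCLM G y u v)) w
      + G y (christoffelCLM G y u v) (christoffelCLM G y x w)
      + G y (fderiv ℝ (christoffelCLM G) y x u v) w
      + G y (christoffelCLM G y x v) (christoffelCLM G y u w)
      + G y v (christoffelCLM G y x (christoffelCLM G y u w))
      + G y v (fderiv ℝ (christoffelCLM G) y x u w) := by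
  have hd := hG.differentiableAt hy
  have hΓ := hG.differentiableAt_christoffelCLM hy
  have hD := differentiableAt_of_contDiffOn hG.isOpen
    (contDiffOn_fderiv hG.isOpen hG.contDiffOn) hy
  have hΓc (a b : Model d) : DifferentiableAt ℝ (fun z => christoffelCLM G z a b) y :=
    (hΓ.clm_apply (differentiableAt_const a)).clm_apply (differentiableAt_const b)
  have key := congrArg (fun L => L x) (fderiv_eq_of_eqOn hG.isOpen
    (fun z hz => hG.fderiv_eq hz u v w) hy)
  rw [fderiv_apply_const₂ (hD.clm_apply (differentiableAt_const u)), fderiv_apply_const hD,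
    fderiv_fun_add ((hd.clm_apply (hΓc u v)).clm_apply (differentiableAt_const w))
      ((hd.clm_apply (differentiableAt_const v)).clm_apply (hΓc u w)), add_apply,
    fderiv_apply_field₂ hd (hΓc u v) (differentiableAt_const w),
    fderiv_apply_field₂ hd (differentiableAt_const v) (hΓc u w), fderiv_apply_const₂ hΓ,
    fderiv_apply_const₂ hΓ, hG.fderiv_eq hy, hG.fderiv_eq hy] at key
  rw [key]
  simp
  ring

/-- The curvature endomorphisms are skew with respect to the metric. -/
theorem inner_curvatureCLM (hG : IsMetricOn G U) (hy : y ∈ U) (u v w x : Model d) :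
    G y (curvatureCLM G y u v w) x = -G y w (curvatureCLM G y u v x) := by
  -- Commuting second derivatives of the metric: the terms symmetric in `u` and `v` drop out and the
  -- rest is the skewness of R(u, v).
  have h := congrArg (fun L => L w x) (fderiv_fderiv_symm hG.isOpen hG.contDiffOn hy u v)
  simp only [hG.fderiv_fderiv_eq hy] at h
  simp only [curvatureCLM_apply, map_add, map_sub, add_apply, sub_apply,
    ContinuousLinearMap.comp_apply]
  linarith

theorem fderiv_curvatureCLM (hG : IsMetricOn G U) (hy : y ∈ U) (x u v : Model d) :
    fderiv ℝ (curvatureCLM G) y x u v =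
      fderiv ℝ (fderiv ℝ (christoffelCLM G)) y x u v
      - fderiv ℝ (fderiv ℝ (christoffelCLM G)) y x v u
      + ((christoffelCLM G y u).comp (fderiv ℝ (christoffelCLM G) y x v)
        + (fderiv ℝ (christoffelCLM G) y x u).comp (christoffelCLM G y v))
      - ((christoffelCLM G y v).comp (fderiv ℝ (christoffelCLM G) y x u)
        + (fderiv ℝ (christoffelCLM G) y x v).comp (christoffelCLM G y u)) := by
  have hΓ := hG.differentiableAt_christoffelCLM hy
  have hD := differentiableAt_of_contDiffOn hG.isOpen
    (contDiffOn_fderiv hG.isOpen hG.contDiffOn_christoffelCLM) hy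
  have hR := differentiableAt_of_contDiffOn hG.isOpen hG.contDiffOn_curvatureCLM hy
  have hΓc (a : Model d) : DifferentiableAt ℝ (fun z => christoffelCLM G z a) y :=
    hΓ.clm_apply (differentiableAt_const a)
  have hDc (a b : Model d) : DifferentiableAt ℝ (fun z => fderiv ℝ (christoffelCLM G) z a b) y :=
    (hD.clm_apply (differentiableAt_const a)).clm_apply (differentiableAt_const b)
  have hcomp (a b : Model d) :
      DifferentiableAt ℝ (fun z => (christoffelCLM G z a).comp (christoffelCLM G z b)) y :=
    (hΓc a).clm_comp (hΓc b)
  rw [← fderiv_apply_const₂ hR]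
  simp only [curvatureCLM_apply]
  rw [fderiv_fun_sub (((hDc u v).fun_sub (hDc v u)).fun_add (hcomp u v)) (hcomp v u),
    fderiv_fun_add ((hDc u v).fun_sub (hDc v u)) (hcomp u v), fderiv_fun_sub (hDc u v) (hDc v u),
    fderiv_clm_comp (hΓc u) (hΓc v), fderiv_clm_comp (hΓc v) (hΓc u)]
  simp [fderiv_apply_const₂ hD, fderiv_apply_const hΓ]

/-- This is the form dR + [Γ, R] = 0: Christoffel corrections in the first two arguments of R cancel
in the cyclic sum, so only commutators remain. The second derivatives of Γ cancel by symmetry. -/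
theorem second_bianchi (hG : IsMetricOn G U) (hy : y ∈ U) (u v w : Model d) :
    fderiv ℝ (curvatureCLM G) y u v w + fderiv ℝ (curvatureCLM G) y v w u
      + fderiv ℝ (curvatureCLM G) y w u v
      + ((christoffelCLM G y u).comp (curvatureCLM G y v w)
        - (curvatureCLM G y v w).comp (christoffelCLM G y u))
      + ((christoffelCLM G y v).comp (curvatureCLM G y w u)
        - (curvatureCLM G y w u).comp (christoffelCLM G y v))
      + ((christoffelCLM G y w).comp (curvatureCLM G y u v)
        - (curvatureCLM G y u v).comp (christoffelCLM G y w)) = 0 := by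
  have h (a b : Model d) := fderiv_fderiv_symm hG.isOpen hG.contDiffOn_christoffelCLM hy a b
  ext1 x
  simp only [hG.fderiv_curvatureCLM hy, curvatureCLM_apply, map_add, map_sub, add_apply, sub_apply,
    ContinuousLinearMap.comp_apply, zero_apply, h v u, h w u, h w v]
  abel

theorem ricci_eq_sum (hG : IsMetricOn G U) (hy : y ∈ U) (v w : Model d) :
    ricci G y v w = ∑ i : Fin d, curvatureCLM G y (EuclideanSpace.single i 1) v w i := by
  simp [ricci, hG.curvatureCLM_eq_curvature hy]

theorem fderiv_ricci (hG : IsMetricOn G U) (hy : y ∈ U) (x v w : Model d) :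
    fderiv ℝ (fun z => ricci G z v w) y x =
      ∑ i : Fin d, fderiv ℝ (curvatureCLM G) y x (EuclideanSpace.single i 1) v w i := by
  have hR := differentiableAt_of_contDiffOn hG.isOpen hG.contDiffOn_curvatureCLM hy
  rw [fderiv_eq_of_eqOn hG.isOpen (fun z hz => hG.ricci_eq_sum hz v w) hy]
  have hd (i : Fin d) : HasFDerivAt
      (fun z => curvatureCLM G z (EuclideanSpace.single i 1) v w i)
      ((EuclideanSpace.proj i).comp
        (fderiv ℝ (fun z => curvatureCLM G z (EuclideanSpace.single i 1) v w) y)) y :=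
    (EuclideanSpace.proj i : Model d →L[ℝ] ℝ).hasFDerivAt.comp y
      (((hR.clm_apply (differentiableAt_const _)).clm_apply
        (differentiableAt_const v)).clm_apply (differentiableAt_const w)).hasFDerivAt
  rw [(HasFDerivAt.fun_sum fun i _ => hd i).fderiv, sum_apply]
  refine Finset.sum_congr rfl fun i _ => ?_
  rw [ContinuousLinearMap.comp_apply,
    fderiv_apply_const₂ (hR.clm_apply (differentiableAt_const _)), fderiv_apply_const hR]
  rfl

/-- The second argument is a variable field because ζ is not constant in a general chart. -/
theorem fderiv_hessian (hG : IsMetricOn G U) {F : Model d → ℝ} (hF : ContDiffOn ℝ ∞ F U)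
    (hy : y ∈ U) {b : Model d → Model d} (hb : DifferentiableAt ℝ b y) (x a : Model d) :
    fderiv ℝ (fun z => hessian G F z a (b z)) y x =
      fderiv ℝ (fderiv ℝ (fderiv ℝ F)) y x a (b y)
      + fderiv ℝ (fderiv ℝ F) y a (fderiv ℝ b y x)
      - (fderiv ℝ (fderiv ℝ F) y x (christoffelCLM G y a (b y))
        + fderiv ℝ F y (fderiv ℝ (christoffelCLM G) y x a (b y)
          + christoffelCLM G y a (fderiv ℝ b y x))) := by
  have hF₁ := contDiffOn_fderiv hG.isOpen hF
  have hd₁ := differentiableAt_of_contDiffOn hG.isOpen hF₁ hy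
  have hd₂ := differentiableAt_of_contDiffOn hG.isOpen (contDiffOn_fderiv hG.isOpen hF₁) hy
  have ha := differentiableAt_const (𝕜 := ℝ) (x := y) a
  have hΓ := hG.differentiableAt_christoffelCLM hy
  have hΓb := (hΓ.clm_apply ha).clm_apply hb
  simp only [hessian, ← christoffelCLM_apply]
  rw [fderiv_fun_sub ((hd₂.clm_apply ha).clm_apply hb) (hd₁.clm_apply hΓb), sub_apply,
    fderiv_apply_field₂ hd₂ ha hb, fderiv_apply_field hd₁ hΓb, fderiv_apply_field₂ hΓ ha hb]
  simp

end IsMetricOn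

/-! ### Para-cosymplectic structures: the characteristic field is parallel. -/

/-- A para-cosymplectic structure in coordinates, on an open subset of `ℝᵈ`. -/
structure IsParaCosymplecticOn (G : Model d → Model d →L[ℝ] Model d →L[ℝ] ℝ)
    (P : Model d → Model d →L[ℝ] Model d) (Z : Model d → Model d) (N : Model d → Model d →L[ℝ] ℝ)
    (U : Set (Model d)) : Prop extends IsMetricOn G U where
  contDiffOn_φ : ContDiffOn ℝ ∞ P U
  contDiffOn_ζ : ContDiffOn ℝ ∞ Z U
  contDiffOn_η : ContDiffOn ℝ ∞ N U
  φ_sq : ∀ y ∈ U, ∀ u, P y (P y u) = u - N y u • Z y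
  η_ζ : ∀ y ∈ U, N y (Z y) = 1
  compatible : ∀ y ∈ U, ∀ u v, G y (P y u) (P y v) = -G y u v + N y u * N y v
  d_eta : ∀ y ∈ U, ∀ u v, extDerivOne N y u v = 0
  d_fundamentalForm : ∀ y ∈ U, ∀ u v w,
    extDerivTwo (fun z => ((P z).precomp ℝ).comp (G z)) y u v w = 0
  normal : ∀ y ∈ U, ∀ u v, nijenhuis P y u v = 0

namespace IsParaCosymplecticOn

variable {G : Model d → Model d →L[ℝ] Model d →L[ℝ] ℝ} {P : Model d → Model d →L[ℝ] Model d}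
  {Z : Model d → Model d} {N : Model d → Model d →L[ℝ] ℝ} {U : Set (Model d)} {y : Model d}

/-- From φ²ζ = 0, applying φ² to φζ shows φζ = cζ with c = η(φζ); then c²ζ = φ²ζ = 0 forces c = 0.
-/
theorem φ_ζ (h : IsParaCosymplecticOn G P Z N U) (hy : y ∈ U) : P y (Z y) = 0 := by
  have h₁ : P y (P y (Z y)) = 0 := by rw [h.φ_sq y hy, h.η_ζ y hy, one_smul, sub_self]
  have h₂ : P y (Z y) = N y (P y (Z y)) • Z y := by
    have := h.φ_sq y hy (P y (Z y))
    rw [h₁, map_zero] at this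
    exact (sub_eq_zero.1 this.symm)
  generalize N y (P y (Z y)) = c at h₂
  have hZ : Z y ≠ 0 := fun hZ => by simpa [hZ] using h.η_ζ y hy
  rw [h₂, map_smul, h₂, smul_smul] at h₁
  have hc : c = 0 := by simpa [hZ] using h₁
  rw [h₂, hc, zero_smul]

/-- Computing φ³u in two ways gives η(φu)ζ = η(u)φζ = 0. -/
theorem η_φ (h : IsParaCosymplecticOn G P Z N U) (hy : y ∈ U) (u : Model d) :
    N y (P y u) = 0 := by
  have hZ : Z y ≠ 0 := fun hZ => by simpa [hZ] using h.η_ζ y hy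
  have h₁ := h.φ_sq y hy (P y u)
  rw [h.φ_sq y hy u, map_sub, map_smul, h.φ_ζ hy] at h₁
  rw [smul_zero, sub_zero, eq_comm, sub_eq_self, smul_eq_zero] at h₁
  exact h₁.resolve_right hZ

theorem inner_ζ (h : IsParaCosymplecticOn G P Z N U) (hy : y ∈ U) (u : Model d) :
    G y u (Z y) = N y u := by
  have := h.compatible y hy u (Z y)
  rw [h.φ_ζ hy, h.η_ζ y hy] at this
  simp at this
  linarith

theorem inner_φ_left (h : IsParaCosymplecticOn G P Z N U) (hy : y ∈ U) (u v : Model d) :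
    G y (P y u) v = -G y u (P y v) := by
  have h₁ := h.compatible y hy u (P y v)
  rw [h.φ_sq y hy, h.η_φ hy, map_sub, map_smul, h.inner_ζ hy, h.η_φ hy] at h₁
  simpa using h₁

theorem inner_φ_right (h : IsParaCosymplecticOn G P Z N U) (hy : y ∈ U) (u v : Model d) :
    G y u (P y v) = -G y v (P y u) := by
  rw [h.symm y hy, h.inner_φ_left hy]

theorem fderiv_η_symm (h : IsParaCosymplecticOn G P Z N U) (hy : y ∈ U) (u v : Model d) :
    fderiv ℝ N y u v = fderiv ℝ N y v u :=
  sub_eq_zero.1 (h.d_eta y hy u v)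

theorem differentiableAt_φ (h : IsParaCosymplecticOn G P Z N U) (hy : y ∈ U) :
    DifferentiableAt ℝ P y := differentiableAt_of_contDiffOn h.isOpen h.contDiffOn_φ hy

theorem differentiableAt_ζ (h : IsParaCosymplecticOn G P Z N U) (hy : y ∈ U) :
    DifferentiableAt ℝ Z y := differentiableAt_of_contDiffOn h.isOpen h.contDiffOn_ζ hy

theorem differentiableAt_η (h : IsParaCosymplecticOn G P Z N U) (hy : y ∈ U) :
    DifferentiableAt ℝ N y := differentiableAt_of_contDiffOn h.isOpen h.contDiffOn_η hy

theorem fderiv_φ_ζ (h : IsParaCosymplecticOn G P Z N U) (hy : y ∈ U) (u : Model d) :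
    fderiv ℝ P y u (Z y) = -P y (fderiv ℝ Z y u) := by
  have := congrArg (fun L => L u) (fderiv_eq_of_eqOn h.isOpen (fun z hz => h.φ_ζ hz) hy)
  rw [fderiv_apply_field (h.differentiableAt_φ hy) (h.differentiableAt_ζ hy)] at this
  exact eq_neg_of_add_eq_zero_left (by simpa using this)

theorem η_fderiv_ζ (h : IsParaCosymplecticOn G P Z N U) (hy : y ∈ U) (u : Model d) :
    N y (fderiv ℝ Z y u) = -fderiv ℝ N y u (Z y) := by
  have := congrArg (fun L => L u) (fderiv_eq_of_eqOn h.isOpen (fun z hz => h.η_ζ z hz) hy)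
  rw [fderiv_apply_field (h.differentiableAt_η hy) (h.differentiableAt_ζ hy)] at this
  exact eq_neg_of_add_eq_zero_right (by simpa using this)

theorem η_fderiv_φ (h : IsParaCosymplecticOn G P Z N U) (hy : y ∈ U) (u v : Model d) :
    N y (fderiv ℝ P y u v) = -fderiv ℝ N y u (P y v) := by
  have hP := h.differentiableAt_φ hy
  have := congrArg (fun L => L u) (fderiv_eq_of_eqOn h.isOpen (fun z hz => h.η_φ hz v) hy)
  rw [fderiv_apply_field (h.differentiableAt_η hy) (hP.clm_apply (differentiableAt_const v)),
    fderiv_apply_const hP] at this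
  exact eq_neg_of_add_eq_zero_right (by simpa using this)

theorem fderiv_inner_ζ (h : IsParaCosymplecticOn G P Z N U) (hy : y ∈ U) (u v : Model d) :
    fderiv ℝ G y u v (Z y) = fderiv ℝ N y u v - G y v (fderiv ℝ Z y u) := by
  have := congrArg (fun L => L u) (fderiv_eq_of_eqOn h.isOpen (fun z hz => h.inner_ζ hz v) hy)
  rw [fderiv_apply_field₂ (h.differentiableAt hy) (differentiableAt_const v)
    (h.differentiableAt_ζ hy), fderiv_apply_const (h.differentiableAt_η hy)] at this
  simp at this
  linarith

theorem nijenhuis_eq (h : IsParaCosymplecticOn G P Z N U) (hy : y ∈ U) (u v : Model d) :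
    fderiv ℝ P y (P y u) v - fderiv ℝ P y (P y v) u + P y (fderiv ℝ P y v u)
      - P y (fderiv ℝ P y u v) = 0 := by
  have hP := h.differentiableAt_φ hy
  have := h.normal y hy u v
  simp only [nijenhuis, VectorField.lieBracket, fderiv_apply_const hP] at this
  simpa using this

/-- The Lie derivative of `φ` along `ζ` vanishes. -/
theorem lieDerivative_φ (h : IsParaCosymplecticOn G P Z N U) (hy : y ∈ U) (v : Model d) :
    fderiv ℝ P y (Z y) v - fderiv ℝ Z y (P y v) + P y (fderiv ℝ Z y v) = 0 := by
  set L := fderiv ℝ P y (Z y) v - fderiv ℝ Z y (P y v) + P y (fderiv ℝ Z y v) with hL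
  -- The Nijenhuis tensor on (ζ, v) sees only φL. The missing η-component of L is controlled by dη =
  -- 0, and φ² = I - η ⊗ ζ then recovers L.
  have h₁ : P y L = 0 := by
    have := h.nijenhuis_eq hy (Z y) v
    rw [h.φ_ζ hy, h.fderiv_φ_ζ hy, h.fderiv_φ_ζ hy] at this
    simp only [hL, map_add, map_sub]
    simp only [map_zero, map_neg, zero_apply] at this
    rw [← neg_eq_zero, ← this]
    abel
  have h₂ : N y L = 0 := by
    simp only [hL, map_add, map_sub, h.η_fderiv_φ hy, h.η_fderiv_ζ hy, h.η_φ hy]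
    rw [h.fderiv_η_symm hy (Z y)]
    ring
  have := h.φ_sq y hy L
  simpa [h₁, h₂] using this.symm

theorem fderiv_fundamentalForm (h : IsParaCosymplecticOn G P Z N U) (hy : y ∈ U)
    (u v w : Model d) :
    fderiv ℝ (fun z => ((P z).precomp ℝ).comp (G z)) y u v w =
      fderiv ℝ G y u v (P y w) + G y v (fderiv ℝ P y u w) := by
  have hd : DifferentiableAt ℝ
      (fun z => (((P z).precomp ℝ).comp (G z) : Model d →L[ℝ] Model d →L[ℝ] ℝ)) y := by
    refine differentiableAt_of_contDiffOn h.isOpen ?_ hy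
    rw [contDiffOn_clm_apply]
    intro v
    rw [contDiffOn_clm_apply]
    intro w
    exact (h.contDiffOn.clm_apply contDiffOn_const).clm_apply
      (h.contDiffOn_φ.clm_apply contDiffOn_const)
  have hP := h.differentiableAt_φ hy
  rw [← fderiv_apply_const₂ hd]
  change fderiv ℝ (fun z => G z v (P z w)) y u = _
  rw [fderiv_apply_field₂ (h.differentiableAt hy) (differentiableAt_const v)
    (hP.clm_apply (differentiableAt_const w)), fderiv_apply_const hP]
  simp

/-- The characteristic vector field is a Killing field. -/
theorem lieDerivative_metric (h : IsParaCosymplecticOn G P Z N U) (hy : y ∈ U) (v w : Model d) :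
    fderiv ℝ G y (Z y) v w + G y (fderiv ℝ Z y v) w + G y v (fderiv ℝ Z y w) = 0 := by
  -- Since Φ(ζ, ·) = 0, Cartan's formula turns dΦ = 0 into L_ζΦ = 0; as L_ζφ = 0, what remains is
  -- (L_ζg)(v, φw) = 0.
  have hφ (w : Model d) : fderiv ℝ G y (Z y) v (P y w) + G y (fderiv ℝ Z y v) (P y w)
      + G y v (fderiv ℝ Z y (P y w)) = 0 := by
    have h₁ := h.d_fundamentalForm y hy (Z y) v w
    rw [extDerivTwo, h.fderiv_fundamentalForm hy, h.fderiv_fundamentalForm hy,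
      h.fderiv_fundamentalForm hy, h.φ_ζ hy, h.fderiv_φ_ζ hy, h.symm y hy (Z y),
      h.inner_ζ hy, h.η_fderiv_φ hy, h.fderiv_symm hy w, h.fderiv_inner_ζ hy] at h₁
    have h₂ := congrArg (G y v) (h.lieDerivative_φ hy w)
    simp only [map_add, map_sub, map_neg, map_zero, h.inner_φ_right hy w] at h₁ h₂
    rw [h.symm y hy (P y v), h.inner_φ_right hy _ v] at h₁
    have h₃ := h.inner_φ_right hy (fderiv ℝ Z y v) w
    linarith
  -- Here (L_ζg)(v, ζ) = (L_ζη)(v), which vanishes because η is closed and η(ζ) = 1.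
  have hζ : fderiv ℝ G y (Z y) v (Z y) + G y (fderiv ℝ Z y v) (Z y)
      + G y v (fderiv ℝ Z y (Z y)) = 0 := by
    rw [h.fderiv_inner_ζ hy, h.inner_ζ hy, h.η_fderiv_ζ hy, h.fderiv_η_symm hy v]
    ring
  have hw : w = P y (P y w) + N y w • Z y := by rw [h.φ_sq y hy]; abel
  have h₁ := hφ (P y w)
  rw [hw]
  simp only [map_add, map_smul, smul_eq_mul]
  linear_combination h₁ + N y w * hζ

/-- The characteristic vector field is parallel. -/
theorem fderiv_ζ (h : IsParaCosymplecticOn G P Z N U) (hy : y ∈ U) (u : Model d) :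
    fderiv ℝ Z y u = -christoffelCLM G y u (Z y) := by
  refine h.eq_of_inner_eq hy fun w => ?_
  have h₁ := h.inner_christoffelCLM hy u (Z y) w
  rw [h.fderiv_symm hy u, h.fderiv_inner_ζ hy, h.fderiv_inner_ζ hy, h.fderiv_η_symm hy u] at h₁
  -- In the Koszul formula for Γ(u, ζ), closedness has cancelled the derivatives of η; the Killing
  -- equation replaces ∂_ζg, leaving -2g(∂_uζ, w).
  have h₂ := h.lieDerivative_metric hy u w
  rw [map_neg, neg_apply]
  rw [h.symm y hy w] at h₁
  linarith

theorem fderiv_η (h : IsParaCosymplecticOn G P Z N U) (hy : y ∈ U) (u v : Model d) :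
    fderiv ℝ N y u v = N y (christoffelCLM G y u v) := by
  have h₁ := h.fderiv_inner_ζ hy u v
  rw [h.fderiv_eq hy, h.fderiv_ζ hy, map_neg, h.inner_ζ hy] at h₁
  linarith

/-! ### Curvature in the direction of the characteristic field. -/

/-- Integrability condition of ∂_uζ = -Γ(u, ζ): the failure of second derivatives of ζ to commute
would be R(u, v)ζ up to sign. -/
theorem curvatureCLM_ζ_right (h : IsParaCosymplecticOn G P Z N U) (hy : y ∈ U) (u v : Model d) :
    curvatureCLM G y u v (Z y) = 0 := by
  have hZ := h.differentiableAt_ζ hy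
  have hΓ := h.differentiableAt_christoffelCLM hy
  have hDZ := differentiableAt_of_contDiffOn h.isOpen
    (contDiffOn_fderiv h.isOpen h.contDiffOn_ζ) hy
  have key (a b : Model d) : fderiv ℝ (fderiv ℝ Z) y a b =
      -(fderiv ℝ (christoffelCLM G) y a b (Z y)
        - christoffelCLM G y b (christoffelCLM G y a (Z y))) := by
    have := congrArg (fun L => L a) (fderiv_eq_of_eqOn h.isOpen (fun z hz => h.fderiv_ζ hz b) hy)
    rw [fderiv_apply_const hDZ, fderiv_fun_neg, neg_apply,
      fderiv_apply_field₂ hΓ (differentiableAt_const b) hZ, h.fderiv_ζ hy] at this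
    rw [this]
    simp
    abel
  have := fderiv_fderiv_symm h.isOpen h.contDiffOn_ζ hy u v
  rw [key, key, neg_inj] at this
  rw [curvatureCLM_apply]
  simp only [add_apply, sub_apply, ContinuousLinearMap.comp_apply]
  rw [← sub_eq_zero] at this
  rw [← this]
  abel

/-- The trilinear form g(R(ζ, u)v, w) is symmetric in (u, v) by the first Bianchi identity and skew
in (v, w), hence zero. -/
theorem curvatureCLM_ζ_left (h : IsParaCosymplecticOn G P Z N U) (hy : y ∈ U) (u : Model d) :
    curvatureCLM G y (Z y) u = 0 := by
  have hs (u v : Model d) : curvatureCLM G y (Z y) u v = curvatureCLM G y (Z y) v u := by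
    have := h.first_bianchi hy (Z y) u v
    rw [h.curvatureCLM_ζ_right hy, add_zero, curvatureCLM_antisymm G y v] at this
    exact sub_eq_zero.1 (by simpa [sub_eq_add_neg] using this)
  have ha (u v w : Model d) := h.inner_curvatureCLM hy (Z y) u v w
  ext1 v
  refine h.eq_of_inner_eq hy fun w => ?_
  have e (u v w : Model d) : G y (curvatureCLM G y (Z y) u v) w =
      -G y (curvatureCLM G y (Z y) u w) v := by rw [ha, h.symm y hy]
  have h₁ := e u v w
  have h₂ := e w u v
  have h₃ := e v w u
  rw [hs w u, hs w v] at h₂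
  rw [hs v u] at h₃
  simp only [map_zero, zero_apply]
  linarith

theorem curvatureCLM_ζ_mid (h : IsParaCosymplecticOn G P Z N U) (hy : y ∈ U) (u : Model d) :
    curvatureCLM G y u (Z y) = 0 := by
  rw [curvatureCLM_antisymm, h.curvatureCLM_ζ_left hy, neg_zero]

/-- The covariant derivative of the curvature along the characteristic vector field vanishes. -/
theorem fderiv_curvatureCLM_ζ (h : IsParaCosymplecticOn G P Z N U) (hy : y ∈ U) (v w : Model d) :
    fderiv ℝ (curvatureCLM G) y (Z y) v w =
      (curvatureCLM G y v w).comp (christoffelCLM G y (Z y))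
      - (christoffelCLM G y (Z y)).comp (curvatureCLM G y v w)
      + curvatureCLM G y (christoffelCLM G y (Z y) v) w
      + curvatureCLM G y v (christoffelCLM G y (Z y) w) := by
  have hZ := h.differentiableAt_ζ hy
  have hR := differentiableAt_of_contDiffOn h.isOpen h.contDiffOn_curvatureCLM hy
  -- Differentiating R(b, ζ) = 0 turns the other two derivative terms of the second Bianchi identity
  -- into curvature terms without derivatives.
  have key (a b : Model d) : fderiv ℝ (curvatureCLM G) y a b (Z y) =
      curvatureCLM G y b (christoffelCLM G y (Z y) a) := by
    have := congrArg (fun L => L a)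
      (fderiv_eq_of_eqOn h.isOpen (fun z hz => h.curvatureCLM_ζ_mid hz b) hy)
    rw [fderiv_apply_field₂ hR (differentiableAt_const b) hZ, h.fderiv_ζ hy,
      h.christoffelCLM_symm hy a] at this
    simpa [add_neg_eq_zero] using this
  have hanti (a b c : Model d) : fderiv ℝ (curvatureCLM G) y a b c =
      -fderiv ℝ (curvatureCLM G) y a c b := by
    rw [← fderiv_apply_const₂ hR, ← fderiv_apply_const₂ hR,
      fderiv_eq_of_eqOn h.isOpen (fun z _ => curvatureCLM_antisymm G z b c) hy, fderiv_fun_neg,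
      neg_apply]
  have hb := h.second_bianchi hy (Z y) v w
  rw [h.curvatureCLM_ζ_left hy, h.curvatureCLM_ζ_mid hy, key, hanti w, key,
    curvatureCLM_antisymm G y w] at hb
  simp only [ContinuousLinearMap.comp_zero, ContinuousLinearMap.zero_comp, sub_zero,
    add_zero] at hb
  rw [← sub_eq_zero, ← hb]
  abel

theorem ricci_ζ_right (h : IsParaCosymplecticOn G P Z N U) (hy : y ∈ U) (v : Model d) :
    ricci G y v (Z y) = 0 := by
  simp [ricci, ← h.curvatureCLM_eq_curvature hy, h.curvatureCLM_ζ_right hy]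

/-- The covariant derivative of the Ricci tensor along the characteristic vector field vanishes. -/
theorem fderiv_ricci_ζ (h : IsParaCosymplecticOn G P Z N U) (hy : y ∈ U) (v w : Model d) :
    fderiv ℝ (fun z => ricci G z v w) y (Z y) =
      ricci G y (christoffelCLM G y (Z y) v) w + ricci G y v (christoffelCLM G y (Z y) w) := by
  rw [h.fderiv_ricci hy, h.ricci_eq_sum hy, h.ricci_eq_sum hy]
  simp only [h.fderiv_curvatureCLM_ζ hy, add_apply, sub_apply, ContinuousLinearMap.comp_apply,
    PiLp.add_apply, PiLp.sub_apply, Finset.sum_add_distrib, Finset.sum_sub_distrib]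
  -- The only terms left over form the trace of the commutator of Γ(ζ, ·) with u ↦ R(u, v)w.
  have := sum_comp_apply_single_comm (christoffelCLM G y (Z y))
    (((curvatureCLM G y).flip v).flip w)
  simp only [ContinuousLinearMap.flip_apply] at this
  rw [this]
  ring

/-! ### The soliton equation in coordinates. -/

/-- The soliton function of a gradient Ricci soliton with constant coefficient has
vanishing derivative. -/
theorem fderiv_solitonFunction (h : IsParaCosymplecticOn G P Z N U) (hd : 2 ≤ d)
    {F l : Model d → ℝ} {c : ℝ} (hF : ContDiffOn ℝ ∞ F U) (hl : ContDiffOn ℝ ∞ l U)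
    (hsol : ∀ z ∈ U, ∀ u v, c * hessian G F z u v + l z * G z u v + ricci G z u v = 0)
    (hy : y ∈ U) : fderiv ℝ l y = 0 := by
  have hZ := h.differentiableAt_ζ hy
  have hG := h.differentiableAt hy
  have hN := h.differentiableAt_η hy
  have hΓ := h.differentiableAt_christoffelCLM hy
  have hdl := differentiableAt_of_contDiffOn h.isOpen hl hy
  have hF₁ := contDiffOn_fderiv h.isOpen hF
  have hF₂ := contDiffOn_fderiv h.isOpen hF₁
  have hdF₁ := differentiableAt_of_contDiffOn h.isOpen hF₁ hy
  have hdF₂ := differentiableAt_of_contDiffOn h.isOpen hF₂ hy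
  have hc (a : Model d) := differentiableAt_const (𝕜 := ℝ) (x := y) a
  have hRic (u v : Model d) : DifferentiableAt ℝ (fun z => ricci G z u v) y := by
    refine (Filter.EventuallyEq.differentiableAt_iff (Filter.eventually_of_mem
      (h.isOpen.mem_nhds hy) (fun z hz => h.ricci_eq_sum hz u v))).2 ?_
    have hR := differentiableAt_of_contDiffOn h.isOpen h.contDiffOn_curvatureCLM hy
    exact DifferentiableAt.fun_sum fun i _ =>
      (EuclideanSpace.proj i : Model d →L[ℝ] ℝ).differentiableAt.comp y
        (((hR.clm_apply (differentiableAt_const _)).clm_apply (hc u)).clm_apply (hc v))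
  have hH {b : Model d → Model d} (hb : DifferentiableAt ℝ b y) (a : Model d) :
      DifferentiableAt ℝ (fun z => hessian G F z a (b z)) y := by
    simp only [hessian, ← christoffelCLM_apply]
    exact ((hdF₂.clm_apply (hc a)).clm_apply hb).fun_sub
      (hdF₁.clm_apply ((hΓ.clm_apply (hc a)).clm_apply hb))
  -- The soliton equation on (v, ζ) has no Ricci term, so its derivative along u involves only the
  -- Hessian and λη.
  have hmixed (u v : Model d) : c * fderiv ℝ (fun z => hessian G F z v (Z z)) y u
      + (l y * N y (christoffelCLM G y u v) + fderiv ℝ l y u * N y v) = 0 := by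
    have := congrArg (fun L => L u) (fderiv_eq_of_eqOn (g := fun _ => (0 : ℝ))
      (f := fun z => c * hessian G F z v (Z z) + l z * N z v) h.isOpen (fun z hz => by
        have := hsol z hz v (Z z)
        rwa [h.inner_ζ hz, h.ricci_ζ_right hz, add_zero] at this) hy)
    rw [fderiv_fun_add ((hH hZ v).const_mul c) (hdl.fun_mul (hN.clm_apply (hc v))),
      fderiv_const_mul (hH hZ v), fderiv_fun_mul hdl (hN.clm_apply (hc v))] at this
    simpa [fderiv_apply_const hN, h.fderiv_η hy, mul_comm (N y v)] using this
  have halong (u v : Model d) : c * fderiv ℝ (fun z => hessian G F z u v) y (Z y)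
      + (l y * (G y (christoffelCLM G y (Z y) u) v + G y u (christoffelCLM G y (Z y) v))
        + fderiv ℝ l y (Z y) * G y u v)
      + (ricci G y (christoffelCLM G y (Z y) u) v
        + ricci G y u (christoffelCLM G y (Z y) v)) = 0 := by
    have hGuv := (hG.clm_apply (hc u)).clm_apply (hc v)
    have := congrArg (fun L => L (Z y)) (fderiv_eq_of_eqOn (g := fun _ => (0 : ℝ))
      h.isOpen (fun z hz => hsol z hz u v) hy)
    rw [fderiv_fun_add (((hH (hc v) u).const_mul c).fun_add (hdl.fun_mul hGuv)) (hRic u v),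
      fderiv_fun_add ((hH (hc v) u).const_mul c) (hdl.fun_mul hGuv),
      fderiv_const_mul (hH (hc v) u), fderiv_fun_mul hdl hGuv, add_apply,
      h.fderiv_ricci_ζ hy] at this
    simpa [fderiv_apply_const₂ hG, h.fderiv_eq hy, mul_comm (G y u v)] using this
  have key (u v : Model d) : fderiv ℝ l y (Z y) * G y u v = fderiv ℝ l y u * N y v := by
    have e₁ := hmixed u v
    have e₂ := halong u v
    have e₃ := hsol y hy (christoffelCLM G y (Z y) u) v
    have e₄ := hsol y hy u (christoffelCLM G y (Z y) v)
    have e₅ := hsol y hy (christoffelCLM G y u v) (Z y)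
    have s₁ := congrArg (fun L => L v) (fderiv_fderiv_symm h.isOpen hF₁ hy u (Z y))
    have s₂ : fderiv ℝ (fderiv ℝ (fderiv ℝ F)) y u v (Z y) =
        fderiv ℝ (fderiv ℝ (fderiv ℝ F)) y u (Z y) v := by
      rw [← fderiv_apply_const₂ hdF₂, ← fderiv_apply_const₂ hdF₂,
        fderiv_eq_of_eqOn h.isOpen (fun z hz => fderiv_fderiv_symm h.isOpen hF hz v (Z y)) hy]
    have hR := congrArg (fun L => fderiv ℝ F y (L v)) (h.curvatureCLM_ζ_left hy u)
    simp only [curvatureCLM_apply, map_add, map_sub, add_apply, sub_apply,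
      ContinuousLinearMap.comp_apply, zero_apply, map_zero] at hR
    rw [h.fderiv_hessian hF hy hZ, h.fderiv_ζ hy] at e₁
    rw [h.fderiv_hessian hF hy (hc v)] at e₂
    rw [h.inner_ζ hy, h.ricci_ζ_right hy] at e₅
    simp only [hessian, ← christoffelCLM_apply, map_add, map_neg] at e₁ e₂ e₃ e₄ e₅
    simp only [fderiv_fun_const, Pi.zero_apply, zero_apply, map_zero] at e₂
    have t₁ := fderiv_fderiv_symm h.isOpen hF hy v (christoffelCLM G y (Z y) u)
    have t₂ := fderiv_fderiv_symm h.isOpen hF hy (Z y) (christoffelCLM G y u v)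
    rw [h.christoffelCLM_symm hy u (Z y), h.christoffelCLM_symm hy v (Z y),
      h.fderiv_christoffelCLM_symm hy u v (Z y),
      h.christoffelCLM_symm hy v (christoffelCLM G y (Z y) u), s₂, s₁, t₁] at e₁
    rw [t₂] at e₂
    rw [h.christoffelCLM_symm hy _ (Z y)] at e₅
    -- Subtracting `e₃` and `e₄` from `e₂`, and `e₅` from `e₁`, makes the derivatives covariant; ζ
    -- being parallel, `e₁` needs just one correction. The Ricci identity contributes `c * hR`.
    linear_combination e₂ - e₁ - e₃ - e₄ + e₅ + c * hR
  -- The kernel of a covector is nontrivial once `2 ≤ d`.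
  obtain ⟨v, hv, hNv⟩ : ∃ v : Model d, v ≠ 0 ∧ N y v = 0 := by
    by_contra! hcon
    have hinj : Function.Injective (N y : Model d →ₗ[ℝ] ℝ) := by
      rw [← LinearMap.ker_eq_bot, LinearMap.ker_eq_bot']
      intro v hv
      by_contra hv₀
      exact hcon v hv₀ hv
    have := LinearMap.finrank_le_finrank_of_injective hinj
    simp at this
    omega
  have hlZ : fderiv ℝ l y (Z y) = 0 := by
    by_contra hne
    refine hv (h.nondegenerate y hy v fun u => ?_)
    have := key u v
    rw [hNv, mul_zero] at this
    rw [h.symm y hy]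
    exact (mul_eq_zero.1 this).resolve_left hne
  ext1 u
  have := key u (Z y)
  rw [hlZ, h.η_ζ y hy, zero_mul, mul_one] at this
  exact this.symm

end IsParaCosymplecticOn

end Coordinates

/-! ### Transfer of the tensor fields from the manifold to charts. -/

section ChartExpressions

set_option maxSynthPendingDepth 4

variable {d : ℕ} {M : Type*} [TopologicalSpace M] [ChartedSpace (Model d) M]

theorem contDiffOn_comp_extChartAt_symm [IsManifold (𝓡 d) ∞ M] {F : Type*} [NormedAddCommGroup F]
    [NormedSpace ℝ F] {f : M → F} (x₀ : M)
    (hf : ContMDiffOn (𝓡 d) 𝓘(ℝ, F) ∞ f (chartAt (Model d) x₀).source) :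
    ContDiffOn ℝ ∞ (fun y => f ((extChartAt (𝓡 d) x₀).symm y)) (extChartAt (𝓡 d) x₀).target := by
  rw [← contMDiffOn_iff_contDiffOn]
  refine hf.comp (contMDiffOn_extChartAt_symm x₀) fun y hy => ?_
  rw [← extChartAt_source (𝓡 d)]
  exact (extChartAt (𝓡 d) x₀).map_target hy

variable [IsManifold (𝓡 d) ∞ M]

theorem mem_baseSet_of_mem_target (x₀ : M) {y : Model d} (hy : y ∈ (extChartAt (𝓡 d) x₀).target) :
    (extChartAt (𝓡 d) x₀).symm y ∈
      (trivializationAt (Model d) (TangentSpace (𝓡 d)) x₀).baseSet := by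
  rw [TangentBundle.trivializationAt_baseSet, ← extChartAt_source (𝓡 d)]
  exact (extChartAt (𝓡 d) x₀).map_target hy

theorem frame_coframe (x₀ : M) {y : Model d} (hy : y ∈ (extChartAt (𝓡 d) x₀).target)
    (u : TangentSpace (𝓡 d) ((extChartAt (𝓡 d) x₀).symm y)) :
    frame x₀ y (coframe x₀ y u) = u :=
  Bundle.Trivialization.symmL_continuousLinearMapAt _ (mem_baseSet_of_mem_target x₀ hy) u

theorem coframe_frame (x₀ : M) {y : Model d} (hy : y ∈ (extChartAt (𝓡 d) x₀).target)
    (u : Model d) : coframe x₀ y (frame x₀ y u) = u :=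
  Bundle.Trivialization.continuousLinearMapAt_symmL _ (mem_baseSet_of_mem_target x₀ hy) u

theorem coordBilin_apply
    (B : ∀ x : M, TangentSpace (𝓡 d) x →L[ℝ] TangentSpace (𝓡 d) x →L[ℝ] ℝ) (x₀ : M)
    (y u v : Model d) : coordBilin B x₀ y u v =
      B ((extChartAt (𝓡 d) x₀).symm y) (frame x₀ y u) (frame x₀ y v) := rfl

theorem coordOneForm_apply (η : ∀ x : M, TangentSpace (𝓡 d) x →L[ℝ] ℝ) (x₀ : M)
    (y u : Model d) :
    coordOneForm η x₀ y u = η ((extChartAt (𝓡 d) x₀).symm y) (frame x₀ y u) := rfl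

theorem coordEnd_apply (φ : ∀ x : M, TangentSpace (𝓡 d) x →L[ℝ] TangentSpace (𝓡 d) x) (x₀ : M)
    (y u : Model d) :
    coordEnd φ x₀ y u = coframe x₀ y (φ ((extChartAt (𝓡 d) x₀).symm y) (frame x₀ y u)) := rfl

theorem contMDiffOn_coordinateField (x₀ : M) (u : Model d) :
    ContMDiffOn (𝓡 d) ((𝓡 d).prod 𝓘(ℝ, Model d)) ∞
      (fun x => Bundle.TotalSpace.mk' (Model d) (E := TangentSpace (𝓡 d)) x
        ((trivializationAt (Model d) (TangentSpace (𝓡 d) : M → Type _) x₀).symmL ℝ x u))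
      (chartAt (Model d) x₀).source := by
  rw [← TangentBundle.trivializationAt_baseSet (I := 𝓡 d),
    Bundle.Trivialization.contMDiffOn_section_baseSet_iff]
  refine (contMDiffOn_const (c := u)).congr fun x hx => ?_
  rw [Bundle.Trivialization.symmL_apply _ hx, Bundle.Trivialization.apply_mk_symm _ hx]

theorem contMDiffOn_continuousLinearMapAt (x₀ : M) {X : ∀ x : M, TangentSpace (𝓡 d) x}
    (hX : ContMDiffOn (𝓡 d) ((𝓡 d).prod 𝓘(ℝ, Model d)) ∞
      (fun x => Bundle.TotalSpace.mk' (Model d) (E := TangentSpace (𝓡 d)) x (X x))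
      (chartAt (Model d) x₀).source) :
    ContMDiffOn (𝓡 d) 𝓘(ℝ, Model d) ∞
      (fun x => (trivializationAt (Model d) (TangentSpace (𝓡 d) : M → Type _)
        x₀).continuousLinearMapAt ℝ x (X x))
      (chartAt (Model d) x₀).source := by
  rw [← TangentBundle.trivializationAt_baseSet (I := 𝓡 d)] at hX ⊢
  rw [Bundle.Trivialization.contMDiffOn_section_baseSet_iff] at hX
  refine hX.congr fun x hx => ?_
  simp [Bundle.Trivialization.coe_linearMapAt_of_mem _ hx]

theorem contDiffOn_coordBilin {B : ∀ x : M, TangentSpace (𝓡 d) x →L[ℝ] TangentSpace (𝓡 d) x →L[ℝ] ℝ}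
    (hB : ContMDiff (𝓡 d) ((𝓡 d).prod 𝓘(ℝ, Model d →L[ℝ] Model d →L[ℝ] ℝ)) ∞
      (fun x => Bundle.TotalSpace.mk' (Model d →L[ℝ] Model d →L[ℝ] ℝ)
        (E := fun x : M => TangentSpace (𝓡 d) x →L[ℝ] TangentSpace (𝓡 d) x →L[ℝ] ℝ) x (B x)))
    (x₀ : M) : ContDiffOn ℝ ∞ (coordBilin B x₀) (extChartAt (𝓡 d) x₀).target := by
  rw [contDiffOn_clm_apply]
  intro u
  rw [contDiffOn_clm_apply]
  intro v
  refine contDiffOn_comp_extChartAt_symm (f := fun x => B x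
    ((trivializationAt (Model d) (TangentSpace (𝓡 d) : M → Type _) x₀).symmL ℝ x u)
    ((trivializationAt (Model d) (TangentSpace (𝓡 d) : M → Type _) x₀).symmL ℝ x v)) x₀ ?_
  -- A scalar function is treated as a section of the trivial line bundle, so that smoothness of
  -- bundle-map evaluation applies.
  have : ContMDiffOn (𝓡 d) ((𝓡 d).prod 𝓘(ℝ)) ∞
      (fun x => Bundle.TotalSpace.mk' ℝ (E := Bundle.Trivial M ℝ) x (B x
        ((trivializationAt (Model d) (TangentSpace (𝓡 d) : M → Type _) x₀).symmL ℝ x u)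
        ((trivializationAt (Model d) (TangentSpace (𝓡 d) : M → Type _) x₀).symmL ℝ x v)))
      (chartAt (Model d) x₀).source := by
    apply ContMDiffOn.clm_bundle_apply₂ (F₁ := Model d) (F₂ := Model d)
    · exact hB.contMDiffOn
    · exact contMDiffOn_coordinateField x₀ u
    · exact contMDiffOn_coordinateField x₀ v
  exact fun x hx => (Bundle.contMDiffWithinAt_totalSpace.1 (this x hx)).2

theorem contDiffOn_coordOneForm {η : ∀ x : M, TangentSpace (𝓡 d) x →L[ℝ] ℝ}
    (hη : ContMDiff (𝓡 d) ((𝓡 d).prod 𝓘(ℝ, Model d →L[ℝ] ℝ)) ∞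
      (fun x => Bundle.TotalSpace.mk' (Model d →L[ℝ] ℝ)
        (E := fun x : M => TangentSpace (𝓡 d) x →L[ℝ] ℝ) x (η x)))
    (x₀ : M) : ContDiffOn ℝ ∞ (coordOneForm η x₀) (extChartAt (𝓡 d) x₀).target := by
  rw [contDiffOn_clm_apply]
  intro u
  refine contDiffOn_comp_extChartAt_symm (f := fun x => η x
    ((trivializationAt (Model d) (TangentSpace (𝓡 d) : M → Type _) x₀).symmL ℝ x u)) x₀ ?_
  have : ContMDiffOn (𝓡 d) ((𝓡 d).prod 𝓘(ℝ)) ∞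
      (fun x => Bundle.TotalSpace.mk' ℝ (E := Bundle.Trivial M ℝ) x (η x
        ((trivializationAt (Model d) (TangentSpace (𝓡 d) : M → Type _) x₀).symmL ℝ x u)))
      (chartAt (Model d) x₀).source := by
    apply ContMDiffOn.clm_bundle_apply (F₁ := Model d)
    · exact hη.contMDiffOn
    · exact contMDiffOn_coordinateField x₀ u
  exact fun x hx => (Bundle.contMDiffWithinAt_totalSpace.1 (this x hx)).2

theorem contDiffOn_coordEnd {φ : ∀ x : M, TangentSpace (𝓡 d) x →L[ℝ] TangentSpace (𝓡 d) x}
    (hφ : ContMDiff (𝓡 d) ((𝓡 d).prod 𝓘(ℝ, Model d →L[ℝ] Model d)) ∞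
      (fun x => Bundle.TotalSpace.mk' (Model d →L[ℝ] Model d)
        (E := fun x : M => TangentSpace (𝓡 d) x →L[ℝ] TangentSpace (𝓡 d) x) x (φ x)))
    (x₀ : M) : ContDiffOn ℝ ∞ (coordEnd φ x₀) (extChartAt (𝓡 d) x₀).target := by
  rw [contDiffOn_clm_apply]
  intro u
  refine contDiffOn_comp_extChartAt_symm (f := fun x =>
    (trivializationAt (Model d) (TangentSpace (𝓡 d) : M → Type _) x₀).continuousLinearMapAt ℝ x
      (φ x ((trivializationAt (Model d) (TangentSpace (𝓡 d) : M → Type _) x₀).symmL ℝ x u)))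
    x₀ ?_
  refine contMDiffOn_continuousLinearMapAt x₀ ?_
  apply ContMDiffOn.clm_bundle_apply (F₁ := Model d)
  · exact hφ.contMDiffOn
  · exact contMDiffOn_coordinateField x₀ u

theorem contDiffOn_coordVectorField {ζ : ∀ x : M, TangentSpace (𝓡 d) x}
    (hζ : ContMDiff (𝓡 d) (𝓡 d).tangent ∞ (fun x => (⟨x, ζ x⟩ : TangentBundle (𝓡 d) M)))
    (x₀ : M) :
    ContDiffOn ℝ ∞ (fun y => coframe x₀ y (ζ ((extChartAt (𝓡 d) x₀).symm y)))
      (extChartAt (𝓡 d) x₀).target :=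
  contDiffOn_comp_extChartAt_symm x₀ (contMDiffOn_continuousLinearMapAt x₀ hζ.contMDiffOn)

theorem SemiRiemannianMetric.isMetricOn_coordBilin (g : SemiRiemannianMetric d M) (x₀ : M) :
    IsMetricOn (coordBilin g.inner x₀) (extChartAt (𝓡 d) x₀).target where
  isOpen := isOpen_extChartAt_target x₀
  contDiffOn := contDiffOn_coordBilin g.contMDiff x₀
  symm _ _ _ _ := g.symm _ _ _
  nondegenerate y hy u hu := by
    have : frame x₀ y u = 0 := g.nondegenerate _ _ fun v => by
      have := hu (coframe x₀ y v)
      rwa [coordBilin_apply, frame_coframe x₀ hy] at this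
    rw [← coframe_frame x₀ hy u, this, map_zero]

theorem AlmostParacontactMetricStructure.IsParaCosymplectic.isParaCosymplecticOn
    {A : AlmostParacontactMetricStructure d M} (hA : A.IsParaCosymplectic) (x₀ : M) :
    IsParaCosymplecticOn (coordBilin A.g.inner x₀) (coordEnd A.φ x₀)
      (fun y => coframe x₀ y (A.ζ ((extChartAt (𝓡 d) x₀).symm y))) (coordOneForm A.η x₀)
      (extChartAt (𝓡 d) x₀).target where
  toIsMetricOn := A.g.isMetricOn_coordBilin x₀
  contDiffOn_φ := contDiffOn_coordEnd A.contMDiff_φ x₀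
  contDiffOn_ζ := contDiffOn_coordVectorField A.contMDiff_ζ x₀
  contDiffOn_η := contDiffOn_coordOneForm A.contMDiff_η x₀
  φ_sq y hy u := by
    rw [coordEnd_apply, coordEnd_apply, coordOneForm_apply, frame_coframe x₀ hy, A.φ_sq, map_sub,
      map_smul, coframe_frame x₀ hy]
  η_ζ y hy := by rw [coordOneForm_apply, frame_coframe x₀ hy, A.η_ζ]
  compatible y hy u v := by
    rw [coordBilin_apply, coordEnd_apply, coordEnd_apply, frame_coframe x₀ hy,
      frame_coframe x₀ hy, A.compatible]
    rfl
  d_eta := hA.d_eta x₀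
  d_fundamentalForm y hy u v w := by
    have h := hA.d_fundamentalForm x₀ y hy u v w
    -- The two coordinate forms of Φ are compared only on the chart target, where frame and coframe
    -- are inverse; openness makes this enough for derivatives.
    rw [extDerivTwo, fderiv_eq_of_eqOn (isOpen_extChartAt_target x₀) (fun z hz => ?_) hy] at h
    · exact h
    · ext a b
      change _ = coordBilin A.g.inner x₀ z a (coordEnd A.φ x₀ z b)
      rw [coordBilin_apply, coordBilin_apply, coordEnd_apply, frame_coframe x₀ hz]
      rfl
  normal := hA.normal x₀

end ChartExpressions

/-! ### From vanishing derivative to constancy. -/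

theorem IsHAlmostGradientRicciSoliton.isLocallyConstant {d : ℕ} (hd : 2 ≤ d) {M : Type*}
    [TopologicalSpace M] [ChartedSpace (Model d) M] [IsManifold (𝓡 d) ∞ M]
    {A : AlmostParacontactMetricStructure d M} (hA : A.IsParaCosymplectic)
    {h f lam : M → ℝ} {c : ℝ} (hc : ∀ x, h x = c)
    (hs : IsHAlmostGradientRicciSoliton A.g h f lam) : IsLocallyConstant lam := by
  rw [IsLocallyConstant.iff_eventually_eq]
  intro x₀
  have hU := isOpen_extChartAt_target (I := 𝓡 d) x₀
  have hl : ContDiffOn ℝ ∞ (coordFun lam x₀) (extChartAt (𝓡 d) x₀).target :=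
    contDiffOn_comp_extChartAt_symm x₀ hs.contMDiff_lam.contMDiffOn
  have hf : ContDiffOn ℝ ∞ (coordFun f x₀) (extChartAt (𝓡 d) x₀).target :=
    contDiffOn_comp_extChartAt_symm x₀ hs.contMDiff_f.contMDiffOn
  have hzero : ∀ y ∈ (extChartAt (𝓡 d) x₀).target, fderiv ℝ (coordFun lam x₀) y = 0 := fun y hy =>
    (hA.isParaCosymplecticOn x₀).fderiv_solitonFunction hd hf hl (fun z hz u v => by
      simpa [coordFun, hc] using hs.soliton_eq x₀ z hz u v) hy
  -- A chart target may be disconnected, so a ball around the image of `x₀` serves as a connected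
  -- domain.
  obtain ⟨r, hr, hball⟩ := Metric.isOpen_iff.1 hU _ (mem_extChartAt_target (I := 𝓡 d) x₀)
  have hcont := (continuousAt_extChartAt (I := 𝓡 d) x₀).preimage_mem_nhds
    (Metric.ball_mem_nhds _ hr)
  filter_upwards [hcont, extChartAt_source_mem_nhds (I := 𝓡 d) x₀] with x hx hxs
  have := Metric.isOpen_ball.eqOn_of_fderiv_eq (𝕜 := ℝ) (convex_ball _ r).isPreconnected
    ((hl.mono hball).differentiableOn (by simp))
    (differentiableOn_const (lam x₀))
    (fun y hy => by rw [hzero y (hball hy), fderiv_fun_const]; rfl)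
    (Metric.mem_ball_self hr) (by simp [coordFun]) hx
  rwa [coordFun, (extChartAt (𝓡 d) x₀).left_inv hxs] at this

end ParaGeom

end

theorem corollary7p3 {M : Type*} [TopologicalSpace M] [ConnectedSpace M]
    [ChartedSpace (EuclideanSpace ℝ (Fin 3)) M] [IsManifold (𝓡 3) ∞ M]
    (A : ParaGeom.AlmostParacontactMetricStructure 3 M) (hA : A.IsParaCosymplectic)
    (h f lam : M → ℝ) (h_const : ∃ c : ℝ, ∀ x, h x = c)
    (h_soliton : ParaGeom.IsHAlmostGradientRicciSoliton A.g h f lam) :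
    ParaGeom.IsHGradientRicciSoliton A.g h f lam := by
  obtain ⟨c, hc⟩ := h_const
  have hloc := h_soliton.isLocallyConstant (by norm_num) hA hc
  obtain ⟨x₀⟩ := (inferInstance : Nonempty M)
  exact ⟨h_soliton, lam x₀, fun x => hloc.apply_eq_of_preconnectedSpace x x₀⟩
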